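/- Let $N\ge 1$, let $\alpha_1,\dots,\alpha_N\ge 0$ with $\sum_{n=1}^N\alpha_n=1$, and for $1\le n\le N$ let $A_n$ be a compactly supported probability measure on $[0,\infty)^n$. For $u$ continuous and bounded on $[0,\infty)$ and $x\ge 0$ put $$\Gamma(u)(x)=\sum_{n=1}^N\alpha_n\int A_n(da)\prod_{k=1}^n u(a_kx),$$ and for $p>0$ put $$\lambda(p)=\sum_{n=1}^N\alpha_n\int A_n(da)\sum_{k=1}^n a_k^p,\qquad \mu(p)=\frac{\lambda(p)-1}{p}.$$ Let $p_0\in(0,\infty]$ be the point where $\mu$ has its minimum over $(0,\infty)$: either $p_0<\infty$ is the unique minimum point of $\mu$, or $p_0=\infty$ and $\mu$ is strictly decreasing on $(0,\infty)$. Assume that such a $p_0$ exists and that $p_0>1$. Let $w_0(x)=e^{-x}$ and $w_{k+1}(x)=\int_0^1\Gamma(w_k)(x\tau^{\mu(1)})\,d\tau$ for $x\ge0$, $k\ge 0$, let the self-similar profile be $w(x)=\lim_{k\to\infty}w_k(x)$, and let $R$ be the probability measure on $[0,\infty)$ that represents it, that is, $w(x)=\int_{[0,\infty)}e^{-\tau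 x}\,R(d\tau)$ for all $x\ge 0$. Denote its moments by $m_s=\int\tau^s\,R(d\tau)\in[0,\infty]$, $s>0$, and let $$I_n(s)=\int A_n(da)\int\prod_{j=1}^nR(d\tau_j)\left[\Big(\sum_{k=1}^na_k\tau_k\Big)^s-\sum_{k=1}^n(a_k\tau_k)^s\right].$$ (i) If $s=1$ is the only solution $s>0$ of the equation $\mu(s)=\mu(1)$, then $m_s<\infty$ for every $s>0$. (ii) If this equation has exactly two solutions $s=1$ and $s=s_*>1$ in $(0,\infty)$, then $m_s<\infty$ for $0<s<s_*$ and $m_s=\infty$ for $s>s_*$. (iii) In the situation of (ii), $m_{s_*}<\infty$ only if, for every $n\in\{2,\dots,N\}$ with $\alpha_n>0$, the integral defining $I_n(s_*)$ converges absolutely and $I_n(s_*)=0$. -/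

import Mathlib

open MeasureTheory Filter Topology Set
open scoped NNReal ENNReal

noncomputable section

/-- The data of the multi-linear operator
`Γ(u)(x) = ∑_{n=1}^N α_n ∫ A_n(da) ∏_{k=1}^n u(a_k x)`:
weights `α_n ≥ 0` with `∑_{n=1}^N α_n = 1`, and, for `n = 1, …, N`, a compactly supported
probability measure `A_n` on `[0,∞)^n` (the paper's "generalized density" `A_n(a) da`).
Only the entries with `1 ≤ n ≤ N` play a role; the others are padding.
The measures `A_n` need not be symmetric under permutations of coordinates. -/
structure MaxwellModel where
  N : ℕ
  α : ℕ → ℝ≥0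
  sum_α : ∑ n ∈ Finset.Icc 1 N, α n = 1
  A : (n : ℕ) → Measure (Fin n → ℝ≥0)
  prob_A : ∀ n, IsProbabilityMeasure (A n)
  compact_supp : ∃ r : ℝ≥0, ∀ n ∈ Finset.Icc 1 N, A n {a | r ^ 2 < ∑ k, a k ^ 2} = 0

namespace MaxwellModel

/-- `Γ(u)(x)`; only used for `x ≥ 0`. -/
def Gam (M : MaxwellModel) (u : ℝ → ℝ) (x : ℝ) : ℝ :=
  ∑ n ∈ Finset.Icc 1 M.N, (M.α n : ℝ) * ∫ a, ∏ k, u ((a k : ℝ) * x) ∂(M.A n)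

/-- `λ(p) = ∑_{n=1}^N α_n ∫ A_n(da) ∑_{k=1}^n a_k^p`, which satisfies `L x^p = λ(p) x^p` for the
linearization `L` of `Γ` at the constant function `1`. -/
def lam (M : MaxwellModel) (p : ℝ) : ℝ :=
  ∑ n ∈ Finset.Icc 1 M.N, (M.α n : ℝ) * ∫ a, ∑ k, (a k : ℝ) ^ p ∂(M.A n)

/-- The spectral function `μ(p) = (λ(p) - 1) / p`, `p > 0`. -/
def spec (M : MaxwellModel) (p : ℝ) : ℝ := (M.lam p - 1) / p

/-- `p₀ ∈ (0,∞]` is the point where the spectral function has its minimum over `(0,∞)`: either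
`p₀` is finite and is the unique minimum point, or `p₀ = ∞` and `μ` is decreasing on `(0,∞)`. -/
def IsMinPoint (M : MaxwellModel) (p₀ : ℝ≥0∞) : Prop :=
  (p₀ = ⊤ ∧ StrictAntiOn M.spec (Ioi 0)) ∨
    ∃ q : ℝ, 0 < q ∧ p₀ = ENNReal.ofReal q ∧ ∀ p : ℝ, 0 < p → p ≠ q → M.spec q < M.spec p

/-- The roots `s > 0` of the equation `μ(s) = μ(1)`. -/
def roots (M : MaxwellModel) : Set ℝ := {s | 0 < s ∧ M.spec s = M.spec 1}

/-- The integral operator `Γ_μ(u)(x) = ∫_0^1 Γ(u)(x τ^μ) dτ`; the self-similar equation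
`μ x w'(x) + w(x) = Γ(w)(x)` in integral form is `w = Γ_μ(w)`. -/
def GamInt (M : MaxwellModel) (μ : ℝ) (u : ℝ → ℝ) (x : ℝ) : ℝ :=
  ∫ τ in (0 : ℝ)..1, M.Gam u (x * τ ^ μ)

/-- The iteration `w_0(x) = e^{-x}`, `w_{k+1} = Γ_{μ(1)}(w_k)`. -/
def iter (M : MaxwellModel) : ℕ → ℝ → ℝ
  | 0 => fun x => Real.exp (-x)
  | k + 1 => M.GamInt (M.spec 1) (M.iter k)

/-- `w` is the self-similar profile on `[0,∞)`: the pointwise limit of the iteration. -/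
def IsProfile (M : MaxwellModel) (w : ℝ → ℝ) : Prop :=
  ∀ x : ℝ, 0 ≤ x → Tendsto (fun k => M.iter k x) atTop (𝓝 (w x))

/-- The measure `R(dτ)` on `[0,∞)` represents the self-similar profile `w`: its Laplace
transform `x ↦ ∫ e^{-τ x} R(dτ)` is `w` on `[0,∞)`. -/
def Represents (M : MaxwellModel) (R : Measure ℝ≥0) : Prop :=
  M.IsProfile fun x => ∫ τ, Real.exp (-((τ : ℝ) * x)) ∂(R)

/-- `g_n^{(s)}(y_1,…,y_n) = (∑ y_k)^s - ∑ y_k^s`. -/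
def g (n : ℕ) (s : ℝ) (y : Fin n → ℝ≥0) : ℝ :=
  ((∑ k, y k : ℝ≥0) : ℝ) ^ s - ∑ k, (y k : ℝ) ^ s

/-- The integrand of `I_n(s)` as a function of `(a, τ)`. -/
def integrandI (n : ℕ) (s : ℝ) (z : (Fin n → ℝ≥0) × (Fin n → ℝ≥0)) : ℝ :=
  g n s fun k => z.1 k * z.2 k

/-- The measure `A_n(da) ∏_j R(dτ_j)`. -/
def measI (M : MaxwellModel) (R : Measure ℝ≥0) (n : ℕ) :
    Measure ((Fin n → ℝ≥0) × (Fin n → ℝ≥0)) :=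
  (M.A n).prod (Measure.pi fun _ => R)

/-- `I_n(s) = ∫ A_n(da) ∫ ∏_j R(dτ_j) g_n^{(s)}(a_1 τ_1, …, a_n τ_n)`. -/
def I (M : MaxwellModel) (R : Measure ℝ≥0) (n : ℕ) (s : ℝ) : ℝ :=
  ∫ z, integrandI n s z ∂(M.measI R n)

end MaxwellModel

/-- The moment `m_s = ∫ τ^s R(dτ)`, with values in `[0,∞]`. -/
def moment (R : Measure ℝ≥0) (s : ℝ) : ℝ≥0∞ := ∫⁻ τ, (τ : ℝ≥0∞) ^ s ∂(R)

end

/-! On the side of laws the iteration is a smoothing transform: `smoothing` sends `R` to the law of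
U^μ(1) ∑ a_k τ_k, with U uniform and the τ_k independent copies from `R`. First moments along the
iteration stay equal to 1, so convergence of Laplace transforms upgrades to weak convergence, and
`R` is a fixed point (`Represents.smoothing_eq`). Taking s-th moments gives (1 + μ(1)s) m_s = E(∑
a_k τ_k)^s.

For s ≥ 1 the right side is at least λ(s) m_s, by superadditivity of the power, and at most λ(s) m_s
+ C m_{s-1} m_1 (`exists_moment_mix_le`). Hence the sign of `excess s` = λ(s) - 1 - μ(1)s = s(μ(s) -
μ(1)) decides. If it is negative, the upper bound makes the moment recursion contracting, and
uniform bounds along the iteration pass to `R`. If it is positive, a finite nonzero m_s contradicts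
the lower bound. If it is zero and m_s is finite, the lower bound is an equality, and so is its
contribution from each n.

Since λ is convex, so is `excess`. It vanishes at 1 and, as p₀ > 1, is negative somewhere beyond 1;
so it is negative between 1 and the next root and positive after that root. The lower bounds also
need `R` not to be the unit mass at 0 (`Represents.moment_ne_zero`). -/

/-! ### Inequalities for powers of sums -/

theorem NNReal.sum_rpow_le_rpow_sum {ι : Type*} (t : Finset ι) {s : ℝ} (hs : 1 ≤ s) (y : ι → ℝ≥0) :
    ∑ k ∈ t, y k ^ s ≤ (∑ k ∈ t, y k) ^ s := by
  classical
  induction t using Finset.induction_on with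
  | empty => simp
  | insert i t hi ih =>
    rw [Finset.sum_insert hi, Finset.sum_insert hi]
    exact (add_le_add_right ih _).trans (NNReal.add_rpow_le_rpow_add _ _ hs)

/-- Bernoulli's inequality for the base y/(y+t) = 1 - t/(y+t), multiplied by (y+t)^s. -/
theorem NNReal.add_rpow_le_rpow_add_mul {s : ℝ} (hs : 1 ≤ s) (y t : ℝ≥0) :
    (y + t) ^ s ≤ y ^ s + s.toNNReal * (y + t) ^ (s - 1) * t := by
  rcases eq_or_ne (y + t) 0 with h | h
  · rw [h, NNReal.zero_rpow (by linarith)]; exact zero_le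
  have hS : 0 < (y : ℝ) + t := by exact_mod_cast pos_iff_ne_zero.mpr h
  rw [← NNReal.coe_le_coe]
  push_cast
  rw [Real.coe_toNNReal s (by linarith)]
  have hb : -1 ≤ -(t / ((y : ℝ) + t)) := by
    rw [neg_le_neg_iff, div_le_one hS]
    exact le_add_of_nonneg_left y.coe_nonneg
  have h1 := one_add_mul_self_le_rpow_one_add hb hs
  have h2 : 1 + -(t / ((y : ℝ) + t)) = y / ((y : ℝ) + t) := by field_simp; ring
  rw [h2, Real.div_rpow y.coe_nonneg hS.le, le_div_iff₀ (Real.rpow_pos_of_pos hS s)] at h1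
  have h3 : ((y : ℝ) + t) ^ s = ((y : ℝ) + t) ^ (s - 1) * ((y : ℝ) + t) := by
    rw [← Real.rpow_add_one hS.ne']; congr 1; ring
  have h4 : t / ((y : ℝ) + t) * ((y : ℝ) + t) ^ s = ((y : ℝ) + t) ^ (s - 1) * t := by
    rw [h3]; field_simp
  nlinarith

/-- Expand around the largest term y_i, which satisfies ∑ y_k ≤ n y_i; summing over all i then
removes the dependence on the maximizing index. The error contains only products of two different
variables with exponents s-1 and 1, so by independence it costs no moment of order s. -/
theorem NNReal.rpow_sum_le_sum_rpow_add {n : ℕ} {s : ℝ} (hs : 1 ≤ s) (y : Fin n → ℝ≥0) :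
    (∑ k, y k) ^ s ≤ ∑ k, y k ^ s +
      s.toNNReal * (n : ℝ≥0) ^ (s - 1) * ∑ i, ∑ j ∈ Finset.univ.erase i, y i ^ (s - 1) * y j := by
  rcases n.eq_zero_or_pos with rfl | hn
  · simp [NNReal.zero_rpow (show s ≠ 0 by linarith)]
  have : Nonempty (Fin n) := ⟨⟨0, hn⟩⟩
  obtain ⟨i, hi⟩ := Finite.exists_max y
  have hsplit : ∑ k, y k = y i + ∑ j ∈ Finset.univ.erase i, y j :=
    (Finset.add_sum_erase _ _ (Finset.mem_univ i)).symm
  have hle : ∑ k, y k ≤ n * y i := by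
    refine (Finset.sum_le_card_nsmul _ _ _ fun k _ => hi k).trans ?_
    simp
  calc (∑ k, y k) ^ s
      ≤ y i ^ s + s.toNNReal * (∑ k, y k) ^ (s - 1) * ∑ j ∈ Finset.univ.erase i, y j := by
        rw [hsplit]; exact NNReal.add_rpow_le_rpow_add_mul hs _ _
    _ ≤ ∑ k, y k ^ s + s.toNNReal * (n * y i) ^ (s - 1) * ∑ j ∈ Finset.univ.erase i, y j := by
        gcongr
        exact Finset.single_le_sum (f := fun k => y k ^ s) (fun _ _ => zero_le)
          (Finset.mem_univ i)
    _ = ∑ k, y k ^ s + s.toNNReal * (n : ℝ≥0) ^ (s - 1) *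
          ∑ j ∈ Finset.univ.erase i, y i ^ (s - 1) * y j := by
        rw [NNReal.mul_rpow, ← Finset.mul_sum]; ring
    _ ≤ _ := by
        gcongr
        exact Finset.single_le_sum
          (f := fun i => ∑ j ∈ Finset.univ.erase i, y i ^ (s - 1) * y j) (fun _ _ => zero_le)
            (Finset.mem_univ i)

/-! ### Laplace transforms and weak convergence -/

/-- The Laplace transform `x ↦ ∫ e^{-τ x} R(dτ)` of a measure on `[0,∞)`. -/
noncomputable def laplace (R : Measure ℝ≥0) (x : ℝ) : ℝ := ∫ τ, Real.exp (-((τ : ℝ) * x)) ∂(R)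

theorem exp_neg_mul_mem_Icc (τ : ℝ≥0) {x : ℝ} (hx : 0 ≤ x) :
    Real.exp (-((τ : ℝ) * x)) ∈ Icc (0 : ℝ) 1 :=
  ⟨(Real.exp_pos _).le, Real.exp_le_one_iff.mpr (neg_nonpos.mpr (mul_nonneg τ.coe_nonneg hx))⟩

theorem integrable_exp_neg_mul (R : Measure ℝ≥0) [IsFiniteMeasure R] {x : ℝ} (hx : 0 ≤ x) :
    Integrable (fun τ : ℝ≥0 => Real.exp (-((τ : ℝ) * x))) R := by
  refine Integrable.of_bound (C := 1) (by fun_prop) (ae_of_all _ fun τ => ?_)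
  rw [Real.norm_eq_abs, abs_of_nonneg (exp_neg_mul_mem_Icc τ hx).1]
  exact (exp_neg_mul_mem_Icc τ hx).2

theorem laplace_mem_Icc (R : Measure ℝ≥0) [IsProbabilityMeasure R] {x : ℝ} (hx : 0 ≤ x) :
    laplace R x ∈ Icc (0 : ℝ) 1 := by
  refine ⟨integral_nonneg fun τ => (exp_neg_mul_mem_Icc τ hx).1, ?_⟩
  refine (integral_mono (integrable_exp_neg_mul R hx) (integrable_const 1) fun τ =>
    (exp_neg_mul_mem_Icc τ hx).2).trans ?_
  simp

theorem measurable_laplace (R : Measure ℝ≥0) [IsProbabilityMeasure R] : Measurable (laplace R) := by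
  refine StronglyMeasurable.measurable ?_
  refine StronglyMeasurable.integral_prod_right (f := fun (x : ℝ) (τ : ℝ≥0) =>
    Real.exp (-((τ : ℝ) * x))) ?_
  exact Measurable.stronglyMeasurable (by unfold Function.uncurry; fun_prop)

/-- The function `e^{-τ}` as a bounded continuous function on `[0,∞)`. -/
noncomputable def expNegBCF : BoundedContinuousFunction ℝ≥0 ℝ :=
  BoundedContinuousFunction.ofNormedAddCommGroup (fun τ : ℝ≥0 => Real.exp (-(τ : ℝ)))
    (by fun_prop) 1 fun τ => by
      rw [Real.norm_eq_abs, abs_of_nonneg (Real.exp_pos _).le]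
      exact Real.exp_le_one_iff.mpr (neg_nonpos.mpr τ.coe_nonneg)

/-- Powers of e^{-τ} are the exponentials e^{-kτ}, so Laplace transforms at integers control the
algebra generated by e^{-τ}, which separates points. -/
theorem integral_aeval_expNegBCF (R : Measure ℝ≥0) [IsProbabilityMeasure R] (p : Polynomial ℝ) :
    ∫ τ, (Polynomial.aeval expNegBCF p) τ ∂(R) = p.sum fun k c => c * laplace R k := by
  have h (τ : ℝ≥0) : (Polynomial.aeval expNegBCF p) τ =
      ∑ k ∈ p.support, p.coeff k * Real.exp (-((τ : ℝ) * k)) := by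
    rw [Polynomial.aeval_eq_sum_range' (Nat.lt_succ_self _),
      BoundedContinuousFunction.sum_apply]
    rw [← Finset.sum_subset (s₁ := p.support) (s₂ := Finset.range (p.natDegree + 1))]
    · refine Finset.sum_congr rfl fun k _ => ?_
      have : (expNegBCF ^ k) τ = Real.exp (-((τ : ℝ) * k)) := by
        rw [BoundedContinuousFunction.pow_apply]
        change Real.exp (-(τ : ℝ)) ^ k = _
        rw [← Real.exp_nat_mul]; congr 1; ring
      rw [BoundedContinuousFunction.smul_apply, this, smul_eq_mul]
    · exact Polynomial.supp_subset_range_natDegree_succ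
    · intro k _ hk
      rw [Polynomial.notMem_support_iff.mp hk]; simp
  simp_rw [h]
  rw [integral_finsetSum _ fun k _ => (integrable_exp_neg_mul R k.cast_nonneg).const_mul _,
    Polynomial.sum]
  exact Finset.sum_congr rfl fun k _ => integral_const_mul _ _

theorem isTightMeasureSet_of_moment_one_le {S : Set (Measure ℝ≥0)} {C : ℝ≥0∞} (hC : C ≠ ⊤)
    (h : ∀ R ∈ S, moment R 1 ≤ C) : IsTightMeasureSet S := by
  rw [isTightMeasureSet_iff_exists_isCompact_measure_compl_le]
  intro ε hε
  rcases eq_or_ne ε ⊤ with rfl | hε'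
  · exact ⟨∅, isCompact_empty, fun _ _ => le_top⟩
  lift C to ℝ≥0 using hC
  lift ε to ℝ≥0 using hε'
  have hε0 : 0 < ε := by exact_mod_cast hε
  -- The summand 1 keeps the threshold in Markov's inequality nonzero when `C = 0`.
  have hK : 0 < C / ε + 1 := by positivity
  refine ⟨Icc 0 (C / ε + 1), isCompact_Icc, fun R hR => ?_⟩
  have h1 : (Icc 0 (C / ε + 1))ᶜ ⊆ {τ : ℝ≥0 | ((C / ε + 1 : ℝ≥0) : ℝ≥0∞) ≤ (τ : ℝ≥0∞) ^ (1 : ℝ)} := by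
    intro τ hτ
    simp only [mem_compl_iff, mem_Icc, zero_le, true_and, not_le] at hτ
    simp only [mem_ofPred_eq, ENNReal.rpow_one, ENNReal.coe_le_coe]
    exact hτ.le
  refine (measure_mono h1).trans ((meas_ge_le_lintegral_div (by fun_prop)
    (by exact_mod_cast hK.ne') ENNReal.coe_ne_top).trans ?_)
  refine (ENNReal.div_le_div_right (h R hR) _).trans ?_
  refine ENNReal.div_le_of_le_mul ?_
  rw [← ENNReal.coe_mul, ENNReal.coe_le_coe, mul_add, mul_div_cancel₀ _ hε0.ne']
  exact le_self_add

/-- Pointwise convergence of Laplace transforms, together with a bound on the first moments,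
implies weak convergence. -/
theorem tendsto_of_tendsto_laplace {P : ℕ → ProbabilityMeasure ℝ≥0} {Q : ProbabilityMeasure ℝ≥0}
    {C : ℝ≥0∞} (hC : C ≠ ⊤) (hP : ∀ k, moment (P k) 1 ≤ C)
    (h : ∀ x, 0 ≤ x → Tendsto (fun k => laplace (P k) x) atTop (𝓝 (laplace Q x))) :
    Tendsto P atTop (𝓝 Q) := by
  have hstar (a : BoundedContinuousFunction ℝ≥0 ℝ) : star a = a := by ext; simp
  let A : StarSubalgebra ℝ (BoundedContinuousFunction ℝ≥0 ℝ) :=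
    { Algebra.adjoin ℝ {expNegBCF} with star_mem' := fun {a} ha => (hstar a).symm ▸ ha }
  refine ProbabilityMeasure.tendsto_of_tight_of_separatesPoints ℝ (A := A) ?_ ?_ ?_
  · refine isTightMeasureSet_of_moment_one_le hC ?_
    rintro _ ⟨k, rfl⟩
    exact hP k
  · intro x y hxy
    refine ⟨expNegBCF, ⟨_, ⟨expNegBCF, Algebra.subset_adjoin (mem_singleton _), rfl⟩, rfl⟩, ?_⟩
    change Real.exp (-(x : ℝ)) ≠ Real.exp (-(y : ℝ))
    simpa using hxy
  · intro g hg
    have hg' : g ∈ Algebra.adjoin ℝ {expNegBCF} := hg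
    rw [Algebra.adjoin_singleton_eq_range_aeval] at hg'
    obtain ⟨p, rfl⟩ := hg'
    change Tendsto (fun n => ∫ x, (Polynomial.aeval expNegBCF p) x ∂(P n : Measure ℝ≥0)) atTop
      (𝓝 (∫ x, (Polynomial.aeval expNegBCF p) x ∂(Q : Measure ℝ≥0)))
    simp_rw [integral_aeval_expNegBCF, Polynomial.sum]
    exact tendsto_finsetSum _ fun k _ => (h k k.cast_nonneg).const_mul _

/-- Fatou's lemma for weak convergence: the power is unbounded, but nonnegative and continuous, so
the portmanteau inequality on open sets suffices. -/
theorem moment_le_of_tendsto {P : ℕ → ProbabilityMeasure ℝ≥0} {Q : ProbabilityMeasure ℝ≥0}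
    (h : Tendsto P atTop (𝓝 Q)) {s : ℝ} (hs : 0 ≤ s) {C : ℝ≥0∞} (hP : ∀ k, moment (P k) s ≤ C) :
    moment Q s ≤ C := by
  have hm (R : Measure ℝ≥0) : moment R s = ∫⁻ τ, ENNReal.ofReal ((τ : ℝ) ^ s) ∂(R) := by
    refine lintegral_congr fun τ => ?_
    rw [← ENNReal.ofReal_rpow_of_nonneg τ.coe_nonneg hs, ENNReal.ofReal_coe_nnreal]
  simp_rw [hm] at hP ⊢
  refine (lintegral_le_liminf_lintegral_of_forall_isOpen_measure_le_liminf_measure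
    (μs := fun k => (P k : Measure ℝ≥0)) ?_ (fun τ => by positivity)
    fun G hG => ProbabilityMeasure.le_liminf_measure_open_of_tendsto h hG).trans ?_
  · exact NNReal.continuous_coe.rpow_const fun _ => Or.inr hs
  · exact (liminf_le_liminf (Eventually.of_forall hP)).trans (by simp)

/-! ### The smoothing transform and its fixed point -/

namespace MaxwellModel

instance (M : MaxwellModel) (n : ℕ) : IsProbabilityMeasure (M.A n) := M.prob_A n

instance (M : MaxwellModel) (R : Measure ℝ≥0) [IsProbabilityMeasure R] (n : ℕ) :
    IsProbabilityMeasure (M.measI R n) := by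
  unfold measI; infer_instance

/-- The law of `∑ a_k τ_k` under `∑ α_n A_n(da) ∏ R(dτ_j)`. -/
noncomputable def mix (M : MaxwellModel) (R : Measure ℝ≥0) : Measure ℝ≥0 :=
  ∑ n ∈ Finset.Icc 1 M.N, M.α n •
    (M.measI R n).map fun z => ∑ k, z.1 k * z.2 k

/-- The law of `U^μ ∑ a_k τ_k`, with `U` uniform on `[0,1]` and independent of the sum. It is the
operator on measures that corresponds to `GamInt` on Laplace transforms. -/
noncomputable def smoothing (M : MaxwellModel) (μ : ℝ) (R : Measure ℝ≥0) : Measure ℝ≥0 :=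
  ((volume.restrict (Ioc (0 : ℝ) 1)).prod (M.mix R)).map fun z => z.1.toNNReal ^ μ * z.2

set_option linter.unusedSectionVars false

variable (M : MaxwellModel) (R : Measure ℝ≥0) [IsProbabilityMeasure R]

theorem measurable_sum_mul (n : ℕ) :
    Measurable fun z : (Fin n → ℝ≥0) × (Fin n → ℝ≥0) => ∑ k, z.1 k * z.2 k := by
  fun_prop

theorem measurable_rpow_mul (μ : ℝ) :
    Measurable fun z : ℝ × ℝ≥0 => z.1.toNNReal ^ μ * z.2 := by
  fun_prop

instance : IsProbabilityMeasure (M.mix R) := by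
  refine ⟨?_⟩
  have h (n : ℕ) : (M.measI R n).map (fun z => ∑ k, z.1 k * z.2 k) univ = 1 :=
    (Measure.isProbabilityMeasure_map (measurable_sum_mul n).aemeasurable).measure_univ
  rw [mix, Measure.finsetSum_apply]
  simp only [Measure.smul_apply, h]
  have := congrArg ((↑) : ℝ≥0 → ℝ≥0∞) M.sum_α
  push_cast at this
  simpa [ENNReal.smul_def] using this

instance : IsProbabilityMeasure (volume.restrict (Ioc (0 : ℝ) 1)) := ⟨by simp⟩

instance (μ : ℝ) : IsProbabilityMeasure (M.smoothing μ R) :=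
  Measure.isProbabilityMeasure_map (measurable_rpow_mul μ).aemeasurable

theorem lintegral_mix {f : ℝ≥0 → ℝ≥0∞} (hf : Measurable f) :
    ∫⁻ y, f y ∂(M.mix R) =
      ∑ n ∈ Finset.Icc 1 M.N, M.α n * ∫⁻ z, f (∑ k, z.1 k * z.2 k) ∂(M.measI R n) := by
  rw [mix, lintegral_finsetSum_measure]
  refine Finset.sum_congr rfl fun n _ => ?_
  rw [lintegral_smul_measure, lintegral_map hf (measurable_sum_mul n)]
  rfl

theorem moment_mix {s : ℝ} (hs : 0 ≤ s) : moment (M.mix R) s =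
    ∑ n ∈ Finset.Icc 1 M.N, M.α n *
      ∫⁻ z, (((∑ k, z.1 k * z.2 k) ^ s : ℝ≥0) : ℝ≥0∞) ∂(M.measI R n) := by
  rw [moment, lintegral_mix M R (by fun_prop)]
  simp_rw [ENNReal.coe_rpow_of_nonneg _ hs]

/-- The uniform factor is independent of the sum. Its moment is kept as a lower integral because it
may be infinite when μ is negative. -/
theorem moment_smoothing {μ s : ℝ} (hs : 0 ≤ s) : moment (M.smoothing μ R) s =
    (∫⁻ τ in Ioc (0 : ℝ) 1, ENNReal.ofReal (τ ^ (μ * s))) * moment (M.mix R) s := by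
  rw [moment, smoothing, lintegral_map (by fun_prop) (measurable_rpow_mul μ), moment,
    ← lintegral_prod_mul (by fun_prop) (by fun_prop)]
  have hae : ∀ᵐ z ∂(volume.restrict (Ioc (0 : ℝ) 1)).prod (M.mix R), z.1 ∈ Ioc (0 : ℝ) 1 :=
    Measure.quasiMeasurePreserving_fst.ae (ae_restrict_mem measurableSet_Ioc)
  refine lintegral_congr_ae (hae.mono fun z hz => ?_)
  have h1 : ENNReal.ofReal (z.1 ^ (μ * s)) = ((z.1.toNNReal ^ μ) ^ s : ℝ≥0) := by
    rw [← NNReal.rpow_mul, ← ENNReal.ofReal_coe_nnreal, NNReal.coe_rpow,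
      Real.coe_toNNReal _ hz.1.le]
  simp only [h1]
  rw [← ENNReal.coe_rpow_of_nonneg _ hs, NNReal.mul_rpow, ENNReal.coe_mul,
    ENNReal.coe_rpow_of_nonneg z.2 hs]

theorem lintegral_rpow_Ioc {p : ℝ} (hp : -1 < p) :
    ∫⁻ τ in Ioc (0 : ℝ) 1, ENNReal.ofReal (τ ^ p) = ENNReal.ofReal (1 + p)⁻¹ := by
  rw [← ofReal_integral_eq_lintegral_ofReal, ← intervalIntegral.integral_of_le zero_le_one,
    integral_rpow (Or.inl hp), Real.one_rpow, Real.zero_rpow (by linarith), sub_zero, one_div,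
    add_comm]
  · exact (intervalIntegrable_iff_integrableOn_Ioc_of_le zero_le_one).mp
      (intervalIntegral.intervalIntegrable_rpow' hp)
  · exact (ae_restrict_mem measurableSet_Ioc).mono fun τ hτ => Real.rpow_nonneg hτ.1.le _

theorem lintegral_rpow_Ioc_eq_top {p : ℝ} (hp : p ≤ -1) :
    ∫⁻ τ in Ioc (0 : ℝ) 1, ENNReal.ofReal (τ ^ p) = ⊤ := by
  by_contra h
  refine absurd ((intervalIntegral.integrableOn_Ioo_rpow_iff zero_lt_one).mp ?_) (not_lt.mpr hp)
  refine IntegrableOn.mono_set ?_ Ioo_subset_Ioc_self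
  refine ⟨by fun_prop, ?_⟩
  rw [hasFiniteIntegral_iff_ofReal]
  · exact lt_top_iff_ne_top.mpr h
  · exact (ae_restrict_mem measurableSet_Ioc).mono fun τ hτ => Real.rpow_nonneg hτ.1.le _

theorem norm_prod_laplace_le {n : ℕ} {y : Fin n → ℝ} (hy : ∀ k, 0 ≤ y k) :
    ‖∏ k, laplace R (y k)‖ ≤ 1 := by
  rw [norm_prod]
  refine Finset.prod_le_one (fun _ _ => norm_nonneg _) fun k _ => ?_
  rw [Real.norm_eq_abs, abs_of_nonneg (laplace_mem_Icc R (hy k)).1]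
  exact (laplace_mem_Icc R (hy k)).2

theorem laplace_mix {x : ℝ} (hx : 0 ≤ x) : laplace (M.mix R) x = M.Gam (laplace R) x := by
  have hint (n : ℕ) : Integrable (fun τ : ℝ≥0 => Real.exp (-((τ : ℝ) * x)))
      ((M.measI R n).map fun z => ∑ k, z.1 k * z.2 k) := by
    have := Measure.isProbabilityMeasure_map (μ := M.measI R n) (measurable_sum_mul n).aemeasurable
    exact integrable_exp_neg_mul _ hx
  rw [laplace, mix, integral_finsetSum_measure fun n _ => (hint n).smul_measure_nnreal, Gam]
  refine Finset.sum_congr rfl fun n _ => ?_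
  rw [integral_smul_nnreal_measure, NNReal.smul_def, smul_eq_mul,
    integral_map (measurable_sum_mul n).aemeasurable (hint n).1, measI, integral_prod]
  · congr 1
    refine integral_congr_ae (ae_of_all _ fun a => ?_)
    simp only [laplace]
    rw [← integral_fintype_prod_eq_prod (𝕜 := ℝ)
      (fun (k : Fin n) (τ : ℝ≥0) => Real.exp (-((τ : ℝ) * ((a k : ℝ) * x))))]
    refine integral_congr_ae (ae_of_all _ fun t => ?_)
    simp only
    rw [← Real.exp_sum]
    congr 1
    push_cast
    rw [Finset.sum_mul, ← Finset.sum_neg_distrib]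
    exact Finset.sum_congr rfl fun k _ => by ring
  · exact (hint n).comp_measurable (measurable_sum_mul n)

theorem laplace_smoothing (μ : ℝ) {x : ℝ} (hx : 0 ≤ x) :
    laplace (M.smoothing μ R) x = M.GamInt μ (laplace R) x := by
  have hint := integrable_exp_neg_mul (M.smoothing μ R) hx
  rw [laplace, smoothing, integral_map (measurable_rpow_mul μ).aemeasurable hint.1, integral_prod,
    GamInt, intervalIntegral.integral_of_le zero_le_one]
  · refine setIntegral_congr_fun measurableSet_Ioc fun τ hτ => ?_
    simp only
    rw [← laplace_mix M R (mul_nonneg hx (Real.rpow_nonneg hτ.1.le _)), laplace]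
    refine integral_congr_ae (ae_of_all _ fun t => ?_)
    simp only
    rw [NNReal.coe_mul, NNReal.coe_rpow, Real.coe_toNNReal _ hτ.1.le]
    congr 1; ring
  · exact hint.comp_measurable (measurable_rpow_mul μ)

theorem Gam_congr {u v : ℝ → ℝ} (h : ∀ x, 0 ≤ x → u x = v x) {x : ℝ} (hx : 0 ≤ x) :
    M.Gam u x = M.Gam v x := by
  unfold Gam
  refine Finset.sum_congr rfl fun n _ => ?_
  congr 2 with a
  exact Finset.prod_congr rfl fun k _ => h _ (mul_nonneg (a k).coe_nonneg hx)

theorem GamInt_congr {u v : ℝ → ℝ} (h : ∀ x, 0 ≤ x → u x = v x) (μ : ℝ) {x : ℝ} (hx : 0 ≤ x) :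
    M.GamInt μ u x = M.GamInt μ v x := by
  unfold GamInt
  rw [intervalIntegral.integral_of_le zero_le_one, intervalIntegral.integral_of_le zero_le_one]
  exact setIntegral_congr_fun measurableSet_Ioc fun τ hτ =>
    M.Gam_congr h (mul_nonneg hx (Real.rpow_nonneg hτ.1.le _))

theorem norm_Gam_laplace_le {x : ℝ} (hx : 0 ≤ x) : ‖M.Gam (laplace R) x‖ ≤ 1 := by
  rw [← laplace_mix M R hx, Real.norm_eq_abs, abs_of_nonneg (laplace_mem_Icc _ hx).1]
  exact (laplace_mem_Icc _ hx).2

variable {P : ℕ → Measure ℝ≥0} [∀ k, IsProbabilityMeasure (P k)] {R}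

theorem tendsto_Gam_laplace
    (h : ∀ x, 0 ≤ x → Tendsto (fun k => laplace (P k) x) atTop (𝓝 (laplace R x)))
    {x : ℝ} (hx : 0 ≤ x) :
    Tendsto (fun k => M.Gam (laplace (P k)) x) atTop (𝓝 (M.Gam (laplace R) x)) := by
  unfold Gam
  refine tendsto_finsetSum _ fun n _ => Tendsto.const_mul _ ?_
  refine tendsto_integral_of_dominated_convergence (fun _ => 1) (fun k => ?_)
    (integrable_const _) (fun k => ae_of_all _ fun a => norm_prod_laplace_le (P k) fun i =>
      mul_nonneg (a i).coe_nonneg hx) (ae_of_all _ fun a => ?_)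
  · have := measurable_laplace (P k)
    exact Measurable.aestronglyMeasurable (by fun_prop)
  · exact tendsto_finsetProd _ fun i _ => h _ (mul_nonneg (a i).coe_nonneg hx)

theorem tendsto_GamInt_laplace
    (h : ∀ x, 0 ≤ x → Tendsto (fun k => laplace (P k) x) atTop (𝓝 (laplace R x)))
    (μ : ℝ) {x : ℝ} (hx : 0 ≤ x) :
    Tendsto (fun k => M.GamInt μ (laplace (P k)) x) atTop (𝓝 (M.GamInt μ (laplace R) x)) := by
  unfold GamInt
  simp_rw [intervalIntegral.integral_of_le zero_le_one]
  have hpos {τ : ℝ} (hτ : τ ∈ Ioc (0 : ℝ) 1) : 0 ≤ x * τ ^ μ :=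
    mul_nonneg hx (Real.rpow_nonneg hτ.1.le _)
  refine tendsto_integral_of_dominated_convergence (fun _ => 1) (fun k => ?_)
    (integrable_const _)
    (fun k => (ae_restrict_mem measurableSet_Ioc).mono fun τ hτ =>
      M.norm_Gam_laplace_le (P k) (hpos hτ))
    ((ae_restrict_mem measurableSet_Ioc).mono fun τ hτ => M.tendsto_Gam_laplace h (hpos hτ))
  have hm := measurable_laplace (M.mix (P k))
  refine AEStronglyMeasurable.congr (f := fun τ : ℝ => laplace (M.mix (P k)) (x * τ ^ μ))
    (Measurable.aestronglyMeasurable (by fun_prop)) ?_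
  exact (ae_restrict_mem measurableSet_Ioc).mono fun τ hτ => M.laplace_mix (P k) (hpos hτ)

/-- The measures with Laplace transforms `M.iter k`. -/
noncomputable def iterLaw (M : MaxwellModel) : ℕ → Measure ℝ≥0
  | 0 => Measure.dirac 1
  | k + 1 => M.smoothing (M.spec 1) (M.iterLaw k)

instance isProbabilityMeasure_iterLaw (k : ℕ) : IsProbabilityMeasure (M.iterLaw k) := by
  induction k with
  | zero => unfold iterLaw; infer_instance
  | succ k ih => unfold iterLaw; infer_instance

theorem laplace_iterLaw (k : ℕ) {x : ℝ} (hx : 0 ≤ x) : laplace (M.iterLaw k) x = M.iter k x := by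
  induction k generalizing x with
  | zero => simp [laplace, iterLaw, iter]
  | succ k ih =>
    rw [iterLaw, laplace_smoothing _ _ _ hx, iter]
    exact M.GamInt_congr (fun y hy => ih hy) _ hx

variable {M}

theorem Represents.tendsto_laplace (hR : M.Represents R) {x : ℝ} (hx : 0 ≤ x) :
    Tendsto (fun k => laplace (M.iterLaw k) x) atTop (𝓝 (laplace R x)) := by
  simp_rw [M.laplace_iterLaw _ hx]
  exact hR x hx

/-- A measure that is known to be a probability measure, as an element of `ProbabilityMeasure`. -/
def toProbabilityMeasure (R : Measure ℝ≥0) [h : IsProbabilityMeasure R] :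
    ProbabilityMeasure ℝ≥0 := ⟨R, h⟩

theorem coe_toProbabilityMeasure (R : Measure ℝ≥0) [IsProbabilityMeasure R] :
    (toProbabilityMeasure R : Measure ℝ≥0) = R := rfl

theorem Represents.tendsto_iterLaw (hR : M.Represents R) {C : ℝ≥0∞} (hC : C ≠ ⊤)
    (hP : ∀ k, moment (M.iterLaw k) 1 ≤ C) :
    Tendsto (fun k => toProbabilityMeasure (M.iterLaw k)) atTop (𝓝 (toProbabilityMeasure R)) :=
  tendsto_of_tendsto_laplace hC hP fun _ hx => hR.tendsto_laplace hx

/-- The measure that represents the profile is a fixed point of the smoothing transform. -/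
theorem Represents.smoothing_eq (hR : M.Represents R) {C : ℝ≥0∞} (hC : C ≠ ⊤)
    (hP : ∀ k, moment (M.iterLaw k) 1 ≤ C) : M.smoothing (M.spec 1) R = R := by
  have h1 := (hR.tendsto_iterLaw hC hP).comp (tendsto_add_atTop_nat 1)
  have h2 : Tendsto (fun k => toProbabilityMeasure (M.iterLaw (k + 1))) atTop
      (𝓝 (toProbabilityMeasure (M.smoothing (M.spec 1) R))) := by
    refine tendsto_of_tendsto_laplace hC (fun k => hP (k + 1)) fun x hx => ?_
    simp only [coe_toProbabilityMeasure, iterLaw, laplace_smoothing _ _ _ hx]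
    -- Dominated convergence passes the smoothing step to the limit, so the shifted sequence has
    -- both `R` and its image as weak limits.
    exact M.tendsto_GamInt_laplace (fun y hy => hR.tendsto_laplace hy) _ hx
  have h3 := tendsto_nhds_unique h2 h1
  exact congrArg (fun Q : ProbabilityMeasure ℝ≥0 => (Q : Measure ℝ≥0)) h3

end MaxwellModel

/-! ### Convexity and sign of the spectral excess -/

namespace MaxwellModel

variable (M : MaxwellModel)

theorem exists_ae_le : ∃ r : ℝ≥0, 0 < r ∧ ∀ n ∈ Finset.Icc 1 M.N, ∀ᵐ a ∂(M.A n), ∀ k, a k ≤ r := by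
  obtain ⟨r, hr⟩ := M.compact_supp
  refine ⟨r + 1, by positivity, fun n hn => ?_⟩
  have h : ∀ᵐ a ∂(M.A n), ¬ r ^ 2 < ∑ k, a k ^ 2 := by
    rw [ae_iff]; simpa using hr n hn
  filter_upwards [h] with a ha k
  have h1 : a k ^ 2 ≤ r ^ 2 := (Finset.single_le_sum (f := fun k => a k ^ 2)
    (fun _ _ => zero_le) (Finset.mem_univ k)).trans (not_lt.mp ha)
  exact ((pow_le_pow_iff_left₀ zero_le zero_le two_ne_zero).mp h1).trans le_self_add

theorem integrable_rpow {n : ℕ} (hn : n ∈ Finset.Icc 1 M.N) {p : ℝ} (hp : 0 ≤ p) (k : Fin n) :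
    Integrable (fun a : Fin n → ℝ≥0 => (a k : ℝ) ^ p) (M.A n) := by
  obtain ⟨r, -, hr⟩ := M.exists_ae_le
  refine Integrable.of_bound (C := (r : ℝ) ^ p)
    (Measurable.aestronglyMeasurable (by fun_prop)) ?_
  filter_upwards [hr n hn] with a ha
  rw [Real.norm_eq_abs, abs_of_nonneg (by positivity)]
  gcongr
  exact ha k

theorem integrable_sum_rpow {n : ℕ} (hn : n ∈ Finset.Icc 1 M.N) {p : ℝ} (hp : 0 ≤ p) :
    Integrable (fun a : Fin n → ℝ≥0 => ∑ k, (a k : ℝ) ^ p) (M.A n) :=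
  integrable_finsetSum _ fun k _ => M.integrable_rpow hn hp k

theorem lam_nonneg (p : ℝ) : 0 ≤ M.lam p :=
  Finset.sum_nonneg fun n _ => mul_nonneg (M.α n).coe_nonneg
    (integral_nonneg fun a => Finset.sum_nonneg fun k _ => by positivity)

theorem ofReal_lam {p : ℝ} (hp : 0 ≤ p) : ENNReal.ofReal (M.lam p) =
    ∑ n ∈ Finset.Icc 1 M.N, (M.α n : ℝ≥0∞) * ∫⁻ a, ∑ k, ((a k ^ p : ℝ≥0) : ℝ≥0∞) ∂(M.A n) := by
  rw [lam, ENNReal.ofReal_sum_of_nonneg fun n _ => mul_nonneg (M.α n).coe_nonneg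
    (integral_nonneg fun a => Finset.sum_nonneg fun k _ => by positivity)]
  refine Finset.sum_congr rfl fun n hn => ?_
  rw [ENNReal.ofReal_mul (M.α n).coe_nonneg, ENNReal.ofReal_coe_nnreal,
    ofReal_integral_eq_lintegral_ofReal (M.integrable_sum_rpow hn hp)
      (ae_of_all _ fun a => Finset.sum_nonneg fun k _ => by positivity)]
  congr 1
  refine lintegral_congr fun a => ?_
  rw [ENNReal.ofReal_sum_of_nonneg fun k _ => by positivity]
  exact Finset.sum_congr rfl fun k _ => by
    rw [← NNReal.coe_rpow, ENNReal.ofReal_coe_nnreal]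

/-- The domain leaves out p = 0 so that for a = 0 the function is constantly 0. -/
theorem convexOn_coe_rpow_left (a : ℝ≥0) : ConvexOn ℝ (Ioi 0) fun p : ℝ => (a : ℝ) ^ p := by
  rcases eq_or_ne a 0 with rfl | ha
  · refine (convexOn_const (0 : ℝ) (convex_Ioi 0)).congr fun p hp => ?_
    rw [NNReal.coe_zero, Real.zero_rpow (ne_of_gt hp)]
  · exact (convexOn_rpow_left (NNReal.coe_pos.mpr (pos_iff_ne_zero.mpr ha))).subset
      (subset_univ _) (convex_Ioi 0)

theorem convexOn_lam : ConvexOn ℝ (Ioi 0) M.lam := by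
  refine ⟨convex_Ioi 0, fun p hp q hq s t hs ht hst => ?_⟩
  have hp' : 0 ≤ p := le_of_lt hp
  have hq' : 0 ≤ q := le_of_lt hq
  simp only [lam, smul_eq_mul, Finset.mul_sum]
  rw [← Finset.sum_add_distrib]
  refine Finset.sum_le_sum fun n hn => ?_
  have h1 := (M.integrable_sum_rpow hn hp').const_mul s
  have h2 := (M.integrable_sum_rpow hn hq').const_mul t
  calc (M.α n : ℝ) * ∫ a, ∑ k, (a k : ℝ) ^ (s * p + t * q) ∂(M.A n)
      ≤ M.α n * ∫ a, (s * ∑ k, (a k : ℝ) ^ p + t * ∑ k, (a k : ℝ) ^ q) ∂(M.A n) := by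
        refine mul_le_mul_of_nonneg_left (integral_mono
          (M.integrable_sum_rpow hn (by positivity)) (h1.add h2) fun a => ?_) (M.α n).coe_nonneg
        simp only [Finset.mul_sum]
        rw [← Finset.sum_add_distrib]
        exact Finset.sum_le_sum fun k _ =>
          (convexOn_coe_rpow_left (a k)).2 hp hq hs ht hst
    _ = _ := by rw [integral_add h1 h2, integral_const_mul, integral_const_mul]; ring

/-- The convex function `p (μ(p) - μ(1)) = λ(p) - 1 - p μ(1)`. -/
noncomputable def excess (p : ℝ) : ℝ := M.lam p - (1 + M.spec 1 * p)

theorem convexOn_excess : ConvexOn ℝ (Ioi 0) M.excess := by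
  refine M.convexOn_lam.sub ⟨convex_Ioi 0, fun p _ q _ s t _ _ hst => ?_⟩
  simp only [smul_eq_mul]
  linear_combination hst

theorem excess_one : M.excess 1 = 0 := by simp [excess, spec]

theorem excess_eq {p : ℝ} (hp : 0 < p) : M.excess p = p * (M.spec p - M.spec 1) := by
  have : p * M.spec p = M.lam p - 1 := by rw [spec]; field_simp
  rw [mul_sub, this, excess]; ring

theorem mem_roots_iff {p : ℝ} (hp : 0 < p) : p ∈ M.roots ↔ M.excess p = 0 := by
  rw [M.excess_eq hp, mul_eq_zero, sub_eq_zero]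
  exact ⟨fun h => Or.inr h.2, fun h => ⟨hp, h.resolve_left hp.ne'⟩⟩

variable {M}

theorem IsMinPoint.exists_excess_neg {p₀ : ℝ≥0∞} (hp₀ : M.IsMinPoint p₀) (h1 : 1 < p₀) :
    ∃ q, 1 < q ∧ M.excess q < 0 := by
  have key {q : ℝ} (hq : 1 < q) (h : M.spec q < M.spec 1) : ∃ q, 1 < q ∧ M.excess q < 0 :=
    ⟨q, hq, by
      rw [M.excess_eq (by linarith)]
      exact mul_neg_of_pos_of_neg (by linarith) (by linarith)⟩
  rcases hp₀ with ⟨-, h⟩ | ⟨q, hq, rfl, h⟩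
  · exact key one_lt_two (h (mem_Ioi.mpr one_pos) (mem_Ioi.mpr two_pos) one_lt_two)
  · have hq1 : 1 < q := by
      rw [← ENNReal.ofReal_one] at h1
      exact (ENNReal.ofReal_lt_ofReal_iff hq).mp h1
    exact key hq1 (h 1 one_pos hq1.ne)

/-- A convex function lies below its chords: use the chord from 1 to q when s < q, and the one from
q to t when s > q. -/
theorem excess_neg_of_lt {s t : ℝ} (hs : 1 < s) (hst : s < t)
    (ht : M.excess t ≤ 0) {q : ℝ} (hq : 1 < q) (hqn : M.excess q < 0) : M.excess s < 0 := by
  have h1 : (1 : ℝ) ∈ Ioi (0 : ℝ) := mem_Ioi.mpr one_pos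
  have hq0 : q ∈ Ioi (0 : ℝ) := mem_Ioi.mpr (by linarith)
  have ht0 : t ∈ Ioi (0 : ℝ) := mem_Ioi.mpr (by linarith)
  rcases lt_trichotomy s q with h | rfl | h
  · have := M.convexOn_excess.2 h1 hq0
      (div_nonneg (by linarith) (by linarith) : 0 ≤ (q - s) / (q - 1))
      (div_nonneg (by linarith) (by linarith) : 0 ≤ (s - 1) / (q - 1))
      (by have : q - 1 ≠ 0 := by linarith
          field_simp; ring)
    have e : ((q - s) / (q - 1)) • (1 : ℝ) + ((s - 1) / (q - 1)) • q = s := by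
      have : q - 1 ≠ 0 := by linarith
      simp only [smul_eq_mul]; field_simp; ring
    rw [e, excess_one, smul_zero, zero_add] at this
    exact this.trans_lt (mul_neg_of_pos_of_neg (div_pos (by linarith) (by linarith)) hqn)
  · exact hqn
  · have := M.convexOn_excess.2 hq0 ht0
      (div_nonneg (by linarith) (by linarith) : 0 ≤ (t - s) / (t - q))
      (div_nonneg (by linarith) (by linarith) : 0 ≤ (s - q) / (t - q))
      (by have : t - q ≠ 0 := by linarith
          field_simp; ring)
    have e : ((t - s) / (t - q)) • q + ((s - q) / (t - q)) • t = s := by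
      have : t - q ≠ 0 := by linarith
      simp only [smul_eq_mul]; field_simp; ring
    rw [e] at this
    have h2 : ((t - s) / (t - q)) • M.excess q < 0 :=
      mul_neg_of_pos_of_neg (div_pos (by linarith) (by linarith)) hqn
    have h3 : ((s - q) / (t - q)) • M.excess t ≤ 0 :=
      mul_nonpos_of_nonneg_of_nonpos (div_nonneg (by linarith) (by linarith)) ht
    linarith

/-- Otherwise the intermediate value theorem yields a root in [q, s], different from 1. -/
theorem excess_neg_of_roots_eq {q : ℝ} (hq : 1 < q) (hqn : M.excess q < 0)
    (h : M.roots = {1}) {s : ℝ} (hs : 1 < s) : M.excess s < 0 := by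
  by_contra hneg
  push Not at hneg
  have hqs : q < s := by
    by_contra hsq
    rcases (not_lt.mp hsq).lt_or_eq with hlt | rfl
    · exact absurd (excess_neg_of_lt hs hlt hqn.le hq hqn) (not_lt.mpr hneg)
    · exact absurd hqn (not_lt.mpr hneg)
  have hc : ContinuousOn M.excess (Icc q s) :=
    (M.convexOn_excess.continuousOn isOpen_Ioi).mono fun x hx => mem_Ioi.mpr (by linarith [hx.1])
  obtain ⟨t, ht, ht0⟩ := intermediate_value_Icc hqs.le hc ⟨hqn.le, hneg⟩
  have := (M.mem_roots_iff (by linarith [ht.1])).mpr ht0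
  rw [h, mem_singleton_iff] at this
  linarith [ht.1]

theorem one_add_spec_mul_pos {s : ℝ} (hs : M.excess s < 0) : 0 < 1 + M.spec 1 * s := by
  have := M.lam_nonneg s
  unfold excess at hs
  linarith

/-- For μ(1) < 0 one has 1 + μ(1) > 1 + μ(1)q, which is positive because λ(q) ≥ 0 and the excess at
q is negative. -/
theorem one_add_spec_pos {q : ℝ} (hq : 1 < q) (hqn : M.excess q < 0) : 0 < 1 + M.spec 1 := by
  have := one_add_spec_mul_pos hqn
  rcases le_or_gt 0 (M.spec 1) with h | h
  · linarith
  · nlinarith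

variable (M) in
theorem lam_one : M.lam 1 = 1 + M.spec 1 := by simp [spec]

end MaxwellModel

/-! ### Moment bounds along the iteration -/

theorem moment_le_one_add (R : Measure ℝ≥0) [IsProbabilityMeasure R] {p q : ℝ} (hp : 0 ≤ p)
    (hpq : p ≤ q) : moment R p ≤ 1 + moment R q := by
  calc moment R p ≤ ∫⁻ τ, (1 + (τ : ℝ≥0∞) ^ q) ∂(R) := by
        refine lintegral_mono fun τ => ?_
        rcases le_total (τ : ℝ≥0∞) 1 with h | h
        · exact (ENNReal.rpow_le_one h hp).trans le_self_add
        · exact (ENNReal.rpow_le_rpow_of_exponent_le h hpq).trans le_add_self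
    _ = 1 + moment R q := by
        rw [lintegral_add_left measurable_const, lintegral_const, measure_univ, one_mul, moment]

/-- For y ≤ 1 the quadratic Taylor remainder is at most y² ≤ y^s; for y ≥ 1 already y ≤ y^s. -/
theorem exp_neg_le_one_sub_add_rpow {s y : ℝ} (hs : 1 ≤ s) (hs2 : s ≤ 2) (hy : 0 ≤ y) :
    Real.exp (-y) ≤ 1 - y + y ^ s := by
  rcases le_total y 1 with h | h
  · have h1 : y ^ 2 ≤ y ^ s := by
      rcases hy.eq_or_lt with rfl | hy0
      · simp [Real.zero_rpow (show s ≠ 0 by linarith)]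
      · rw [← Real.rpow_natCast]
        exact Real.rpow_le_rpow_of_exponent_ge hy0 h (by exact_mod_cast hs2)
    have h2 := Real.abs_exp_sub_one_sub_id_le (x := -y) (by rwa [abs_neg, abs_of_nonneg hy])
    have h3 := (abs_le.mp h2).2
    nlinarith
  · have h1 : y ^ (1 : ℝ) ≤ y ^ s := Real.rpow_le_rpow_of_exponent_le h hs
    rw [Real.rpow_one] at h1
    have h2 : Real.exp (-y) ≤ 1 := Real.exp_le_one_iff.mpr (by linarith)
    linarith

/-- The pointwise bound on e^{-y}, integrated. It keeps the Laplace transform below 1 for small x >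
0, uniformly over laws with mean 1 and s-th moment at most B, so it survives a limit. -/
theorem laplace_add_le (R : Measure ℝ≥0) [IsProbabilityMeasure R] (h1 : moment R 1 = 1) {s : ℝ}
    (hs : 1 ≤ s) (hs2 : s ≤ 2) {B : ℝ≥0} (hB : moment R s ≤ B) {x : ℝ≥0} :
    laplace R x + x ≤ 1 + x ^ s * B := by
  have h0 : ENNReal.ofReal (laplace R x) = ∫⁻ τ, ENNReal.ofReal (Real.exp (-((τ : ℝ) * x))) ∂(R) :=
    ofReal_integral_eq_lintegral_ofReal (integrable_exp_neg_mul R x.coe_nonneg)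
      (ae_of_all _ fun τ => (Real.exp_pos _).le)
  have hx : (x : ℝ≥0∞) = ∫⁻ τ, x * (τ : ℝ≥0∞) ^ (1 : ℝ) ∂(R) := by
    rw [lintegral_const_mul _ (by fun_prop), ← moment, h1, mul_one]
  have key : ENNReal.ofReal (laplace R x) + x ≤ 1 + (x : ℝ≥0∞) ^ s * B := by
    calc ENNReal.ofReal (laplace R x) + x
        = ∫⁻ τ, (ENNReal.ofReal (Real.exp (-((τ : ℝ) * x))) + x * (τ : ℝ≥0∞) ^ (1 : ℝ)) ∂(R) := by
          rw [lintegral_add_left (by fun_prop), ← h0, ← hx]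
      _ ≤ ∫⁻ τ, (1 + (x : ℝ≥0∞) ^ s * (τ : ℝ≥0∞) ^ s) ∂(R) := by
          refine lintegral_mono fun τ => ?_
          have h2 := exp_neg_le_one_sub_add_rpow hs hs2 (mul_nonneg τ.coe_nonneg x.coe_nonneg)
          rw [Real.mul_rpow τ.coe_nonneg x.coe_nonneg] at h2
          have h3 : Real.exp (-((τ : ℝ) * x)) + x * τ ≤ 1 + (x : ℝ) ^ s * (τ : ℝ) ^ s := by linarith
          have h4 := ENNReal.ofReal_le_ofReal h3
          rw [ENNReal.ofReal_add (Real.exp_pos _).le (by positivity),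
            ENNReal.ofReal_add zero_le_one (by positivity), ENNReal.ofReal_mul x.coe_nonneg,
            ENNReal.ofReal_mul (by positivity), ← NNReal.coe_rpow, ← NNReal.coe_rpow] at h4
          simp only [ENNReal.ofReal_coe_nnreal, ENNReal.ofReal_one] at h4
          rw [ENNReal.coe_rpow_of_nonneg _ (by linarith),
            ENNReal.coe_rpow_of_nonneg _ (by linarith)] at h4
          simpa using h4
      _ = 1 + (x : ℝ≥0∞) ^ s * moment R s := by
          rw [lintegral_add_left measurable_const, lintegral_const, measure_univ, one_mul,
            lintegral_const_mul _ (by fun_prop), moment]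
      _ ≤ _ := by gcongr
  have hl := (laplace_mem_Icc R x.coe_nonneg).1
  rw [← ENNReal.coe_rpow_of_nonneg _ (by linarith), ← ENNReal.ofReal_coe_nnreal (p := x),
    ← ENNReal.ofReal_add hl x.coe_nonneg, ← ENNReal.coe_one, ← ENNReal.coe_mul,
    ← ENNReal.coe_add, ENNReal.ofReal_le_coe] at key
  exact_mod_cast key

theorem laplace_eq_one_of_moment_eq_zero {R : Measure ℝ≥0} [IsProbabilityMeasure R] {s : ℝ}
    (hs : 0 < s) (h : moment R s = 0) (x : ℝ) : laplace R x = 1 := by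
  rw [moment, lintegral_eq_zero_iff (by fun_prop)] at h
  rw [laplace, integral_congr_ae (g := fun _ => (1 : ℝ)) ?_]
  · simp
  · filter_upwards [h] with τ hτ
    have : τ = 0 := by simpa [hs, hs.le, hs.not_gt] using hτ
    simp [this]

namespace MaxwellModel

variable (M : MaxwellModel)

theorem lintegral_mul_rpow (R : Measure ℝ≥0) [IsProbabilityMeasure R] {n : ℕ} {s : ℝ} (hs : 0 ≤ s)
    (k : Fin n) : ∫⁻ z, (((z.1 k * z.2 k) ^ s : ℝ≥0) : ℝ≥0∞) ∂(M.measI R n) =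
      (∫⁻ a, ((a k ^ s : ℝ≥0) : ℝ≥0∞) ∂(M.A n)) * moment R s := by
  simp_rw [NNReal.mul_rpow, ENNReal.coe_mul]
  rw [measI, lintegral_prod_mul (f := fun a : Fin n → ℝ≥0 => ((a k ^ s : ℝ≥0) : ℝ≥0∞))
    (g := fun t : Fin n → ℝ≥0 => ((t k ^ s : ℝ≥0) : ℝ≥0∞))
    (Measurable.aemeasurable (by fun_prop)) (Measurable.aemeasurable (by fun_prop))]
  congr 1
  rw [(measurePreserving_eval (fun _ : Fin n => R) k).lintegral_comp
    (f := fun τ : ℝ≥0 => ((τ ^ s : ℝ≥0) : ℝ≥0∞)) (by fun_prop), moment]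
  simp_rw [ENNReal.coe_rpow_of_nonneg _ hs]

theorem sum_lintegral_sum_rpow (R : Measure ℝ≥0) [IsProbabilityMeasure R] {s : ℝ} (hs : 0 ≤ s) :
    ∑ n ∈ Finset.Icc 1 M.N, (M.α n : ℝ≥0∞) *
      ∫⁻ z, ((∑ k, (z.1 k * z.2 k) ^ s : ℝ≥0) : ℝ≥0∞) ∂(M.measI R n) =
    ENNReal.ofReal (M.lam s) * moment R s := by
  rw [M.ofReal_lam hs, Finset.sum_mul]
  refine Finset.sum_congr rfl fun n _ => ?_
  rw [mul_assoc]
  congr 1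
  simp_rw [ENNReal.ofNNReal_finsetSum]
  rw [lintegral_finsetSum _ fun k _ => by fun_prop, lintegral_finsetSum _ fun k _ => by fun_prop,
    Finset.sum_mul]
  exact Finset.sum_congr rfl fun k _ => M.lintegral_mul_rpow R hs k

theorem lam_mul_moment_le (R : Measure ℝ≥0) [IsProbabilityMeasure R] {s : ℝ} (hs : 1 ≤ s) :
    ENNReal.ofReal (M.lam s) * moment R s ≤ moment (M.mix R) s := by
  have hs0 : 0 ≤ s := by linarith
  rw [← M.sum_lintegral_sum_rpow R hs0, moment_mix _ _ hs0]
  gcongr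
  exact NNReal.sum_rpow_le_rpow_sum _ hs _

theorem moment_mix_one (R : Measure ℝ≥0) [IsProbabilityMeasure R] :
    moment (M.mix R) 1 = ENNReal.ofReal (M.lam 1) * moment R 1 := by
  rw [← M.sum_lintegral_sum_rpow R zero_le_one, moment_mix _ _ zero_le_one]
  simp_rw [NNReal.rpow_one]

theorem lintegral_cross_le (R : Measure ℝ≥0) [IsProbabilityMeasure R] {n : ℕ} {r : ℝ≥0}
    (hr : ∀ᵐ a ∂(M.A n), ∀ k, a k ≤ r) {p : ℝ} (hp : 0 ≤ p) {i j : Fin n} (hij : i ≠ j) :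
    ∫⁻ z, (((z.1 i * z.2 i) ^ p * (z.1 j * z.2 j) : ℝ≥0) : ℝ≥0∞) ∂(M.measI R n) ≤
      (r ^ p * r : ℝ≥0) * (moment R p * moment R 1) := by
  have hind : ∫⁻ t : Fin n → ℝ≥0, (t i : ℝ≥0∞) ^ p * t j ∂(Measure.pi fun _ => R) =
      moment R p * moment R 1 := by
    have h1 := (ProbabilityTheory.iIndepFun_pi (μ := fun _ : Fin n => R)
      (X := fun _ (τ : ℝ≥0) => τ) fun _ => aemeasurable_id).indepFun hij
    have h2 := h1.comp (φ := fun τ : ℝ≥0 => (τ : ℝ≥0∞) ^ p) (ψ := fun τ : ℝ≥0 => (τ : ℝ≥0∞))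
      (by fun_prop) (by fun_prop)
    have h3 := ProbabilityTheory.lintegral_mul_eq_lintegral_mul_lintegral_of_indepFun
      (by fun_prop) (by fun_prop) h2
    simp only [Pi.mul_apply, Function.comp_apply] at h3
    rw [h3]
    congr 1
    · exact (measurePreserving_eval (fun _ : Fin n => R) i).lintegral_comp
        (f := fun τ : ℝ≥0 => (τ : ℝ≥0∞) ^ p) (by fun_prop)
    · rw [moment]
      simp_rw [ENNReal.rpow_one]
      exact (measurePreserving_eval (fun _ : Fin n => R) j).lintegral_comp
        (f := fun τ : ℝ≥0 => (τ : ℝ≥0∞)) (by fun_prop)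
  have hae : ∀ᵐ z ∂(M.measI R n), ∀ k, z.1 k ≤ r :=
    Measure.quasiMeasurePreserving_fst.ae hr
  calc ∫⁻ z, (((z.1 i * z.2 i) ^ p * (z.1 j * z.2 j) : ℝ≥0) : ℝ≥0∞) ∂(M.measI R n)
      ≤ ∫⁻ z, (r ^ p * r : ℝ≥0) * ((z.2 i : ℝ≥0∞) ^ p * z.2 j) ∂(M.measI R n) := by
        refine lintegral_mono_ae (hae.mono fun z hz => ?_)
        rw [← ENNReal.coe_rpow_of_nonneg _ hp, ← ENNReal.coe_mul, ← ENNReal.coe_mul,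
          ENNReal.coe_le_coe, NNReal.mul_rpow]
        calc z.1 i ^ p * z.2 i ^ p * (z.1 j * z.2 j) ≤ r ^ p * z.2 i ^ p * (r * z.2 j) := by
              gcongr
              · exact hz i
              · exact hz j
          _ = _ := by ring
    _ = _ := by
        rw [measI, lintegral_const_mul _ (by fun_prop), ← hind]
        congr 1
        exact measurePreserving_snd.lintegral_comp
          (f := fun t : Fin n → ℝ≥0 => (t i : ℝ≥0∞) ^ p * t j) (by fun_prop)

/-- The diagonal terms give exactly λ(s) m_s, and the compact supports bound the coefficients of the
cross terms. `C` does not depend on `R`, so the estimate can be iterated. -/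
theorem exists_moment_mix_le {s : ℝ} (hs : 1 ≤ s) : ∃ C : ℝ≥0, ∀ (R : Measure ℝ≥0)
    [IsProbabilityMeasure R], moment (M.mix R) s ≤
      ENNReal.ofReal (M.lam s) * moment R s + C * (moment R (s - 1) * moment R 1) := by
  obtain ⟨r, -, hr⟩ := M.exists_ae_le
  let c : ℕ → ℝ≥0 := fun n => s.toNNReal * (n : ℝ≥0) ^ (s - 1)
  refine ⟨∑ n ∈ Finset.Icc 1 M.N, M.α n * (c n * ∑ i : Fin n, ∑ j ∈ Finset.univ.erase i,
    r ^ (s - 1) * r), fun R _ => ?_⟩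
  have hs0 : 0 ≤ s := by linarith
  rw [← M.sum_lintegral_sum_rpow R hs0, moment_mix _ _ hs0, ENNReal.ofNNReal_finsetSum,
    Finset.sum_mul, ← Finset.sum_add_distrib]
  refine Finset.sum_le_sum fun n hn => ?_
  rw [ENNReal.coe_mul, mul_assoc, ← mul_add]
  gcongr
  calc ∫⁻ z, (((∑ k, z.1 k * z.2 k) ^ s : ℝ≥0) : ℝ≥0∞) ∂(M.measI R n)
      ≤ ∫⁻ z, (((∑ k, (z.1 k * z.2 k) ^ s : ℝ≥0) : ℝ≥0∞) + c n * ∑ i, ∑ j ∈ Finset.univ.erase i,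
          (((z.1 i * z.2 i) ^ (s - 1) * (z.1 j * z.2 j) : ℝ≥0) : ℝ≥0∞)) ∂(M.measI R n) := by
        refine lintegral_mono fun z => ?_
        have := NNReal.rpow_sum_le_sum_rpow_add hs fun k => z.1 k * z.2 k
        simpa only [← ENNReal.coe_mul, ← ENNReal.ofNNReal_finsetSum, ← ENNReal.coe_add,
          ENNReal.coe_le_coe] using this
    _ = ∫⁻ z, ((∑ k, (z.1 k * z.2 k) ^ s : ℝ≥0) : ℝ≥0∞) ∂(M.measI R n) +
          c n * ∑ i, ∑ j ∈ Finset.univ.erase i,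
          ∫⁻ z, (((z.1 i * z.2 i) ^ (s - 1) * (z.1 j * z.2 j) : ℝ≥0) : ℝ≥0∞) ∂(M.measI R n) := by
        rw [lintegral_add_left (by fun_prop), lintegral_const_mul _ (by fun_prop),
          lintegral_finsetSum _ fun i _ => by fun_prop]
        congr 2
        exact Finset.sum_congr rfl fun i _ => lintegral_finsetSum _ fun j _ => by fun_prop
    _ ≤ _ := by
        rw [ENNReal.coe_mul (c n), mul_assoc (c n : ℝ≥0∞), ENNReal.ofNNReal_finsetSum, Finset.sum_mul]
        gcongr with i
        rw [ENNReal.ofNNReal_finsetSum, Finset.sum_mul]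
        exact Finset.sum_le_sum fun j hj => M.lintegral_cross_le R (hr n hn) (by linarith)
          (Finset.ne_of_mem_erase hj).symm

variable {M}

theorem moment_smoothing_of_pos (R : Measure ℝ≥0) [IsProbabilityMeasure R] {s : ℝ} (hs : 0 ≤ s)
    (h : 0 < 1 + M.spec 1 * s) : moment (M.smoothing (M.spec 1) R) s =
      ENNReal.ofReal (1 + M.spec 1 * s)⁻¹ * moment (M.mix R) s := by
  rw [moment_smoothing _ _ hs, lintegral_rpow_Ioc (by linarith)]

theorem moment_iterLaw_one (h : 0 < 1 + M.spec 1) (k : ℕ) : moment (M.iterLaw k) 1 = 1 := by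
  induction k with
  | zero => simp [iterLaw, moment]
  | succ k ih =>
    rw [iterLaw, moment_smoothing_of_pos _ zero_le_one (by rwa [mul_one]), moment_mix_one, ih,
      lam_one, mul_one, mul_one, ← ENNReal.ofReal_mul (by positivity), inv_mul_cancel₀ h.ne',
      ENNReal.ofReal_one]

/-- The moments obey (1 + μ(1)s) m' ≤ λ(s) m + C D with λ(s) < 1 + μ(1)s. The bound 1 + C D / (1 +
μ(1)s - λ(s)) is preserved by this recursion, and its summand 1 covers the initial unit mass at 1.
-/
theorem exists_moment_iterLaw_le_of_excess_neg {s : ℝ} (hs : 1 < s) (hn : M.excess s < 0)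
    {D : ℝ≥0} (hD : ∀ k, moment (M.iterLaw k) (s - 1) ≤ D) :
    ∃ B : ℝ≥0, ∀ k, moment (M.iterLaw k) s ≤ B := by
  have h1 := one_add_spec_pos hs hn
  have hp := one_add_spec_mul_pos hn
  obtain ⟨C, hC⟩ := M.exists_moment_mix_le hs.le
  have hlam : M.lam s < 1 + M.spec 1 * s := by unfold excess at hn; linarith
  have hE : 0 < 1 + M.spec 1 * s - M.lam s := by linarith
  have hB : 0 ≤ 1 + C * D / (1 + M.spec 1 * s - M.lam s) := by positivity
  refine ⟨Real.toNNReal (1 + C * D / (1 + M.spec 1 * s - M.lam s)), fun k => ?_⟩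
  generalize hBe : 1 + C * D / (1 + M.spec 1 * s - M.lam s) = B at hB
  have hB1 : 1 ≤ B := by rw [← hBe]; exact le_add_of_nonneg_right (by positivity)
  have hBC : M.lam s * B + C * D ≤ (1 + M.spec 1 * s) * B := by
    have : (1 + M.spec 1 * s - M.lam s) * B = (1 + M.spec 1 * s - M.lam s) + C * D := by
      rw [← hBe, mul_add, mul_div_cancel₀ _ hE.ne', mul_one]
    linarith
  change _ ≤ ENNReal.ofReal B
  induction k with
  | zero => simpa [iterLaw, moment] using hB1
  | succ k ih =>
    rw [iterLaw, moment_smoothing_of_pos _ (by linarith) hp]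
    calc ENNReal.ofReal (1 + M.spec 1 * s)⁻¹ * moment (M.mix (M.iterLaw k)) s
        ≤ ENNReal.ofReal (1 + M.spec 1 * s)⁻¹ *
          (ENNReal.ofReal (M.lam s) * ENNReal.ofReal B + C * (D * 1)) := by
          gcongr
          refine (hC (M.iterLaw k)).trans ?_
          rw [moment_iterLaw_one h1 k]
          gcongr
          exact hD k
      _ = ENNReal.ofReal ((1 + M.spec 1 * s)⁻¹ * (M.lam s * B + C * D)) := by
          rw [ENNReal.ofReal_mul (by positivity), ENNReal.ofReal_add
            (mul_nonneg (M.lam_nonneg s) hB) (by positivity), ENNReal.ofReal_mul (M.lam_nonneg s),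
            ENNReal.ofReal_mul C.coe_nonneg, ENNReal.ofReal_coe_nnreal, ENNReal.ofReal_coe_nnreal,
            mul_one]
      _ ≤ ENNReal.ofReal B := by
          refine ENNReal.ofReal_le_ofReal ?_
          rwa [inv_mul_le_iff₀ hp]

theorem exists_moment_iterLaw_le {s : ℝ} (hs : 1 < s) (hn : M.excess s < 0) :
    ∃ B : ℝ≥0, ∀ k, moment (M.iterLaw k) s ≤ B := by
  -- Induction in unit steps: for s ≤ 2 the moment of order s-1 is at most 1 + m_1 = 2; for s > 2
  -- the excess at s-1 is again negative.
  obtain ⟨m, hm⟩ := exists_nat_ge s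
  induction m generalizing s with
  | zero => norm_num at hm; linarith
  | succ m ih =>
    rcases le_or_gt s 2 with h2 | h2
    · refine exists_moment_iterLaw_le_of_excess_neg hs hn (D := 2) fun k => ?_
      refine (moment_le_one_add _ (by linarith) (show s - 1 ≤ 1 by linarith)).trans ?_
      rw [moment_iterLaw_one (one_add_spec_pos hs hn)]
      norm_num
    · push_cast at hm
      obtain ⟨D, hD⟩ := ih (s := s - 1) (by linarith)
        (excess_neg_of_lt (by linarith) (sub_one_lt s) hn.le hs hn) (by linarith)
      exact exists_moment_iterLaw_le_of_excess_neg hs hn hD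

/-! ### Moments of the limit law -/

section Profile

variable {R : Measure ℝ≥0} [IsProbabilityMeasure R]

theorem Represents.moment_lt_top (hR : M.Represents R) {s : ℝ} (hs : 1 < s)
    (hn : M.excess s < 0) : moment R s < ⊤ := by
  obtain ⟨B, hB⟩ := exists_moment_iterLaw_le hs hn
  have ht := hR.tendsto_iterLaw ENNReal.one_ne_top
    fun k => (moment_iterLaw_one (one_add_spec_pos hs hn) k).le
  exact (moment_le_of_tendsto ht (by linarith) hB).trans_lt ENNReal.coe_lt_top

/-- Mass cannot collapse to 0 in the limit: a Laplace transform constantly 1 would turn the limit of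
`laplace_add_le` into x ≤ B x^s, which fails when x^(s-1) = 1/(B+1). -/
theorem Represents.moment_ne_zero (hR : M.Represents R) {q : ℝ} (hq : 1 < q)
    (hqn : M.excess q < 0) {p : ℝ} (hp : 0 < p) : moment R p ≠ 0 := by
  intro h0
  obtain ⟨s, hs, hs2, hn⟩ : ∃ s, 1 < s ∧ s ≤ 2 ∧ M.excess s < 0 := by
    rcases le_or_gt q 2 with h | h
    · exact ⟨q, hq, h, hqn⟩
    · exact ⟨2, one_lt_two, le_rfl, excess_neg_of_lt one_lt_two h hqn.le hq hqn⟩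
  obtain ⟨B, hB⟩ := exists_moment_iterLaw_le hs hn
  let x : ℝ≥0 := (1 / (B + 1)) ^ (1 / (s - 1))
  have hB1 : 0 < 1 / (B + 1) := by positivity
  have hx : 0 < x := NNReal.rpow_pos hB1
  have hxs : x ^ (s - 1) = 1 / (B + 1) := by
    rw [← NNReal.rpow_mul, one_div_mul_cancel (by linarith), NNReal.rpow_one]
  have hle : laplace R x + x ≤ 1 + x ^ s * B := by
    refine le_of_tendsto ((hR.tendsto_laplace x.coe_nonneg).add_const _)
      (Eventually.of_forall fun k => ?_)
    exact laplace_add_le _ (moment_iterLaw_one (one_add_spec_pos hs hn) k) hs.le hs2 (hB k)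
  rw [laplace_eq_one_of_moment_eq_zero hp h0] at hle
  have hle' : x ≤ x ^ s * B := by exact_mod_cast le_of_add_le_add_left hle
  have hxs' : x ^ s = x * (1 / (B + 1)) := by
    rw [← hxs, ← NNReal.rpow_one_add' (by linarith)]
    congr 1; ring
  rw [hxs'] at hle'
  have hlt : x * (1 / (B + 1)) * B < x := by
    rw [mul_assoc]
    refine mul_lt_of_lt_one_right hx ?_
    rw [one_div_mul_eq_div, div_lt_one (by positivity)]
    exact lt_add_one B
  exact absurd hle' (not_le.mpr hlt)

theorem Represents.moment_mix_eq (hR : M.Represents R) {q : ℝ} (hq : 1 < q)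
    (hqn : M.excess q < 0) {s : ℝ} (hs : 0 < s) (hm : moment R s ≠ ⊤) :
    0 < 1 + M.spec 1 * s ∧
      moment (M.mix R) s = ENNReal.ofReal (1 + M.spec 1 * s) * moment R s := by
  have heq : moment (M.smoothing (M.spec 1) R) s = moment R s := by
    rw [hR.smoothing_eq ENNReal.one_ne_top
      fun k => (moment_iterLaw_one (one_add_spec_pos hq hqn) k).le]
  have h0 := hR.moment_ne_zero hq hqn hs
  have hpos : 0 < 1 + M.spec 1 * s := by
    -- If 1 + μ(1)s ≤ 0, the uniform factor has infinite moment, and the fixed point equation forces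
    -- m_s to be 0 or ∞.
    by_contra hneg
    rw [moment_smoothing _ _ hs.le, lintegral_rpow_Ioc_eq_top (by linarith)] at heq
    rcases eq_or_ne (moment (M.mix R) s) 0 with h | h
    · rw [h, mul_zero] at heq
      exact h0 heq.symm
    · rw [ENNReal.top_mul h] at heq
      exact hm heq.symm
  refine ⟨hpos, ?_⟩
  rw [← heq, moment_smoothing_of_pos _ hs.le hpos, ← mul_assoc,
    ← ENNReal.ofReal_mul hpos.le, mul_inv_cancel₀ hpos.ne', ENNReal.ofReal_one, one_mul]

/-- A finite m_s is nonzero and cancels from λ(s) m_s ≤ (1 + μ(1)s) m_s, contradicting the sign of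
the excess. -/
theorem Represents.moment_eq_top (hR : M.Represents R) {q : ℝ} (hq : 1 < q)
    (hqn : M.excess q < 0) {s : ℝ} (hs : 1 < s) (hn : 0 < M.excess s) : moment R s = ⊤ := by
  by_contra hm
  obtain ⟨hpos, h⟩ := hR.moment_mix_eq hq hqn (by linarith) hm
  have h1 := M.lam_mul_moment_le R hs.le
  rw [h, ENNReal.mul_le_mul_iff_left (hR.moment_ne_zero hq hqn (by linarith)) hm,
    ENNReal.ofReal_le_ofReal_iff hpos.le] at h1
  unfold excess at hn
  linarith

/-- At a root the weighted sums over n agree while each term on the one side is at most its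
counterpart. The total is finite, so the other terms can be cancelled in `ℝ≥0∞`. -/
theorem Represents.lintegral_eq (hR : M.Represents R) {q : ℝ} (hq : 1 < q)
    (hqn : M.excess q < 0) {s : ℝ} (hs : 1 < s) (h0 : M.excess s = 0) (hm : moment R s ≠ ⊤)
    {n : ℕ} (hn : n ∈ Finset.Icc 1 M.N) (hα : 0 < M.α n) :
    ∫⁻ z, (((∑ k, z.1 k * z.2 k) ^ s : ℝ≥0) : ℝ≥0∞) ∂(M.measI R n) =
        ∫⁻ z, ((∑ k, (z.1 k * z.2 k) ^ s : ℝ≥0) : ℝ≥0∞) ∂(M.measI R n) ∧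
      ∫⁻ z, ((∑ k, (z.1 k * z.2 k) ^ s : ℝ≥0) : ℝ≥0∞) ∂(M.measI R n) ≠ ⊤ := by
  have hs0 : 0 ≤ s := by linarith
  have hlam : M.lam s = 1 + M.spec 1 * s := by unfold excess at h0; linarith
  have h := (hR.moment_mix_eq hq hqn (by linarith) hm).2
  have hsum := M.sum_lintegral_sum_rpow R hs0
  rw [← hlam, ← hsum, moment_mix _ _ hs0] at h
  have hfin : ENNReal.ofReal (M.lam s) * moment R s ≠ ⊤ := ENNReal.mul_ne_top ENNReal.ofReal_ne_top hm
  rw [← hsum] at hfin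
  have hle (m : ℕ) : (M.α m : ℝ≥0∞) *
      ∫⁻ z, ((∑ k, (z.1 k * z.2 k) ^ s : ℝ≥0) : ℝ≥0∞) ∂(M.measI R m) ≤
      M.α m * ∫⁻ z, (((∑ k, z.1 k * z.2 k) ^ s : ℝ≥0) : ℝ≥0∞) ∂(M.measI R m) := by
    gcongr
    exact NNReal.sum_rpow_le_rpow_sum _ hs.le _
  have hα0 : (M.α n : ℝ≥0∞) ≠ 0 := by exact_mod_cast hα.ne'
  rw [← Finset.add_sum_erase _ _ hn] at h hfin
  rw [← Finset.add_sum_erase _ (fun n => (M.α n : ℝ≥0∞) *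
    ∫⁻ z, ((∑ k, (z.1 k * z.2 k) ^ s : ℝ≥0) : ℝ≥0∞) ∂(M.measI R n)) hn] at h
  have hrest := Finset.sum_le_sum fun m (_ : m ∈ (Finset.Icc 1 M.N).erase n) => hle m
  have hlen := (add_le_add_right hrest _).trans h.le
  rw [ENNReal.add_le_add_iff_right (ENNReal.add_ne_top.mp hfin).2] at hlen
  have heq := hlen.antisymm (hle n)
  rw [ENNReal.mul_right_inj hα0 ENNReal.coe_ne_top] at heq
  exact ⟨heq, fun ht => (ENNReal.add_ne_top.mp hfin).1 (by rw [ht, ENNReal.mul_top hα0])⟩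

theorem Represents.integrable_and_I_eq_zero (hR : M.Represents R) {q : ℝ} (hq : 1 < q)
    (hqn : M.excess q < 0) {s : ℝ} (hs : 1 < s) (h0 : M.excess s = 0) (hm : moment R s ≠ ⊤)
    {n : ℕ} (hn : n ∈ Finset.Icc 1 M.N) (hα : 0 < M.α n) :
    Integrable (integrandI n s) (M.measI R n) ∧ M.I R n s = 0 := by
  obtain ⟨heq, hfin⟩ := hR.lintegral_eq hq hqn hs h0 hm hn hα
  have hintegrable {f : (Fin n → ℝ≥0) × (Fin n → ℝ≥0) → ℝ≥0} (hf : Measurable f)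
      (h : ∫⁻ z, (f z : ℝ≥0∞) ∂(M.measI R n) ≠ ⊤) :
      Integrable (fun z => (f z : ℝ)) (M.measI R n) := by
    refine ⟨Measurable.aestronglyMeasurable (by fun_prop), ?_⟩
    rw [hasFiniteIntegral_iff_ofNNReal]
    exact lt_top_iff_ne_top.mpr h
  have h1 := hintegrable (f := fun z => (∑ k, z.1 k * z.2 k) ^ s) (by fun_prop) (heq ▸ hfin)
  have h2 := hintegrable (f := fun z => ∑ k, (z.1 k * z.2 k) ^ s) (by fun_prop) hfin
  have hg : integrandI n s = fun z => (((∑ k, z.1 k * z.2 k) ^ s : ℝ≥0) : ℝ) -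
      ((∑ k, (z.1 k * z.2 k) ^ s : ℝ≥0) : ℝ) := by
    funext z
    simp [integrandI, g]
  rw [I, hg]
  refine ⟨h1.sub h2, ?_⟩
  rw [integral_sub h1 h2, sub_eq_zero]
  rw [lintegral_coe_eq_integral _ h1, lintegral_coe_eq_integral _ h2,
    ENNReal.ofReal_eq_ofReal_iff (integral_nonneg fun _ => NNReal.coe_nonneg _)
      (integral_nonneg fun _ => NNReal.coe_nonneg _)] at heq
  exact heq

end Profile

end MaxwellModel

theorem proposition10p1 (M : MaxwellModel) (p₀ : ℝ≥0∞) (hp₀ : M.IsMinPoint p₀) (h1 : 1 < p₀)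
    (R : Measure ℝ≥0) [IsProbabilityMeasure R] (hR : M.Represents R) :
    (M.roots = {1} → ∀ s : ℝ, 0 < s → moment R s < ⊤) ∧
    (∀ sStar : ℝ, 1 < sStar → M.roots = {1, sStar} →
      (∀ s : ℝ, 0 < s → s < sStar → moment R s < ⊤) ∧
      (∀ s : ℝ, sStar < s → moment R s = ⊤) ∧
      (moment R sStar < ⊤ → ∀ n ∈ Finset.Icc 2 M.N, 0 < M.α n →
        Integrable (MaxwellModel.integrandI n sStar) (M.measI R n) ∧ M.I R n sStar = 0)) := by
  obtain ⟨q, hq, hqn⟩ := hp₀.exists_excess_neg h1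
  have hlt {s t : ℝ} (hs : 0 < s) (hst : s ≤ t) (ht : moment R t < ⊤) : moment R s < ⊤ :=
    (moment_le_one_add R hs.le hst).trans_lt (ENNReal.add_lt_top.mpr ⟨ENNReal.one_lt_top, ht⟩)
  refine ⟨fun hroots s hs => ?_, fun t ht hroots => ?_⟩
  -- The moment of order s+1 is used since the criterion needs an exponent above 1.
  · have hs1 : 1 < s + 1 := by linarith
    exact hlt hs (by linarith) (hR.moment_lt_top hs1
      (MaxwellModel.excess_neg_of_roots_eq hq hqn hroots hs1))
  · have ht0 : M.excess t = 0 := (M.mem_roots_iff (by linarith)).mp (by rw [hroots]; simp)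
    refine ⟨fun s hs hst => ?_, fun s hst => ?_, fun hm n hn hα => ?_⟩
    · obtain ⟨u, hu, hut⟩ := exists_between (max_lt ht hst)
      have hu1 : 1 < u := (le_max_left _ _).trans_lt hu
      exact hlt hs ((le_max_right _ _).trans hu.le) (hR.moment_lt_top hu1
        (MaxwellModel.excess_neg_of_lt hu1 hut ht0.le hq hqn))
    · refine hR.moment_eq_top hq hqn (ht.trans hst) ?_
      -- A nonpositive excess at s > t would make the excess strictly negative at t, where it
      -- vanishes.
      by_contra hneg
      have := MaxwellModel.excess_neg_of_lt ht hst (not_lt.mp hneg) hq hqn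
      linarith
    · have hn1 : n ∈ Finset.Icc 1 M.N :=
        Finset.Icc_subset_Icc_left one_le_two hn
      exact hR.integrable_and_I_eq_zero hq hqn ht ht0 hm.ne hn1 hα
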